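/- Let $\Gamma=\bigoplus_{m\ge 0}(\mathbb C^n)^{\otimes m}$ be the full Fock space, with orthonormal basis $\{e_\alpha\}$ indexed by the words $\alpha$ in the letters $1,\dots,n$, and let $S_jx=e_j\otimes x$ ($j=1,\dots,n$) be the left creation operators. For Hilbert spaces $\mathcal E,\mathcal F$, a contraction $A:\Gamma\otimes\mathcal E\to\Gamma\otimes\mathcal F$ is a *contractive multi-analytic operator* if $A(S_j\otimes I_{\mathcal E})=(S_j\otimes I_{\mathcal F})A$ for all $j$; it is *purely contractive* if $\|P_{e_\emptyset\otimes\mathcal F}A(e_\emptyset\otimes h)\|<\|h\|$ for all $0\ne h\in\mathcal E$. Write $\Delta_A=(I-A^*A)^{1/2}$. Let $\mathcal E_1,\dots,\mathcal E_{k+1}$ be complex Hilbert spaces, $\mathcal E=\mathcal E_1$, $\mathcal E_*=\mathcal E_{k+1}$, and let $\Theta:\Gamma\otimes\mathcal E\to\Gamma\otimes\mathcal E_*$ be a purely contractive, contractive multi-analytic operator satisfying the Szegő condition $$\overline{\Delta_\Theta(\Gamma\otimes\mathcal E)}=\overline{\Delta_\Theta[(\Gamma\otimes\mathcal E)\ominus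 (e_\emptyset\otimes\mathcal E)]}.$$ Let $\Theta=\Theta_k\cdots\Theta_1$, where $\Theta_i:\Gamma\otimes\mathcal E_i\to\Gamma\otimes\mathcal E_{i+1}$ are contractive multi-analytic operators, put $\Delta_i=\Delta_{\Theta_i}$, and let $$Z_k:\overline{\Delta_\Theta(\Gamma\otimes\mathcal E)}\to\overline{\Delta_k(\Gamma\otimes\mathcal E_k)}\oplus\cdots\oplus\overline{\Delta_1(\Gamma\otimes\mathcal E_1)},\qquad Z_k\Delta_\Theta f=\Delta_k\Theta_{k-1}\cdots\Theta_1f\oplus\cdots\oplus\Delta_2\Theta_1 f\oplus\Delta_1f,$$ be the associated isometry. Assume that the factorization is $k$-regular, i.e. that $Z_k$ is unitary (equivalently, the vectors $\Delta_k\Theta_{k-1}\cdots\Theta_1f\oplus\cdots\oplus\Delta_1f$ are dense in the direct sum). Let $\mathcal G_\Theta=\{\Theta w\oplus\Delta_\Theta w: w\in\Gamma\otimes\mathcal E\}$, let $\mathcal H(\Theta)=[(\Gamma\otimes\mathcal E_*)\oplus\overline{\Delta_\Theta(\Gamma\otimes\mathcal E)}]\ominus\mathcal G_\Theta$ be the model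 space, and for $i=1,\dots,k-1$ let $\mathcal M_i\subseteq\mathcal H(\Theta)$ be the subspace in the chain $\mathcal M_1\subseteq\cdots\subseteq\mathcal M_{k-1}$ of joint invariant subspaces of the model row contraction that corresponds to the factorization, namely $$\mathcal M_i=\Big\{\Theta_k\cdots\Theta_{i+1}u\oplus Z_k^*\big(\Delta_k\Theta_{k-1}\cdots\Theta_{i+1}u\oplus\cdots\oplus\Delta_{i+1}u\oplus v_i\oplus\cdots\oplus v_1\big): u\in\Gamma\otimes\mathcal E_{i+1},\ v_j\in\overline{\Delta_j(\Gamma\otimes\mathcal E_j)}\Big\}\ominus\mathcal G_\Theta .$$ Then, for each $i=1,\dots,k-2$, one has $\mathcal M_i=\mathcal M_{i+1}$ if and only if $\Theta_{i+1}$ is a unitary constant, i.e. there is a unitary operator $U:\mathcal E_{i+1}\to\mathcal E_{i+2}$ with $\Theta_{i+1}=I_\Gamma\otimes U$. -/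

import Mathlib

open scoped InnerProductSpace InnerProduct

noncomputable section

namespace RegularFactorization

/-- The Hilbert space `Γ(ℂⁿ) ⊗ E`, realised as the space of square-summable families of vectors of
`E` indexed by the words in the letters `1, …, n` (finite lists over `Fin n`): the family `f` stands
for `∑ α, e_α ⊗ f α`. -/
abbrev Fock (n : ℕ) (E : Type*) [NormedAddCommGroup E] : Type _ :=
  lp (fun _ : List (Fin n) => E) 2

section Fock

/-- Coordinates of `(S_j ⊗ I) f`: the coefficient of `e_j ⊗ e_β` is `f β`, and the coefficients of
the words not beginning with `j` vanish. -/
def creationFun {n : ℕ} {E : Type*} [NormedAddCommGroup E] (j : Fin n) (f : List (Fin n) → E) : List (Fin n) → E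
  | [] => 0
  | i :: β => if i = j then f β else 0

theorem creationFun_hasSum {n : ℕ} {E : Type*} [NormedAddCommGroup E] (j : Fin n) (f : Fock n E) :
    HasSum (fun α => ‖creationFun j f α‖ ^ (2 : ℝ)) (‖f‖ ^ (2 : ℝ)) := by
  have h := lp.hasSum_norm (p := 2) (by norm_num) f
  have hinj : Function.Injective (fun β : List (Fin n) => j :: β) := by
    intro a b hab
    simpa using hab
  rw [← hinj.hasSum_iff]
  · simpa [Function.comp_def, creationFun] using h
  · intro α hα
    rcases α with _ | ⟨i, β⟩
    · simp [creationFun]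
    · have : i ≠ j := by
        rintro rfl
        exact hα ⟨β, rfl⟩
      simp [creationFun, this]

variable {n : ℕ} {E F : Type*} [NormedAddCommGroup E] [InnerProductSpace ℂ E]
  [NormedAddCommGroup F] [InnerProductSpace ℂ F]

/-- The operator `S_j ⊗ I_E` on `Γ ⊗ E`, where `S_j x = e_j ⊗ x` is the `j`-th left creation
operator. -/
def creation (j : Fin n) : Fock n E →ₗᵢ[ℂ] Fock n E where
  toFun f := ⟨creationFun j f,
    memℓp_gen (by simpa using (creationFun_hasSum j f).summable)⟩
  map_add' f g := by
    ext α
    change creationFun j (⇑(f + g)) α = creationFun j f α + creationFun j g α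
    rcases α with _ | ⟨i, β⟩
    · simp [creationFun]
    · by_cases h : i = j <;> simp [creationFun, h]
  map_smul' c f := by
    ext α
    change creationFun j (⇑(c • f)) α = c • creationFun j f α
    rcases α with _ | ⟨i, β⟩
    · simp [creationFun]
    · by_cases h : i = j <;> simp [creationFun, h]
  norm_map' f := by
    have h2 : (0 : ℝ) < (2 : ENNReal).toReal := by norm_num
    have h1 := lp.hasSum_norm (p := 2) h2 (⟨creationFun j f,
      memℓp_gen (by simpa using (creationFun_hasSum j f).summable)⟩ : Fock n E)
    have h3 := creationFun_hasSum j f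
    have h4 := h1.unique (by simpa using h3)
    simp only [ENNReal.toReal_ofNat, Real.rpow_ofNat] at h4
    exact (pow_left_inj₀ (norm_nonneg _) (norm_nonneg _) two_ne_zero).1 h4

/-- A contractive multi-analytic operator: a contraction intertwining the operators `S_j ⊗ I`. -/
structure IsContractiveMultiAnalytic (Θ : Fock n E →L[ℂ] Fock n F) : Prop where
  intertwines : ∀ (j : Fin n) (f : Fock n E), Θ (creation j f) = creation j (Θ f)
  contractive : ‖Θ‖ ≤ 1

/-- `Θ` is purely contractive: `‖P_F Θ (e_∅ ⊗ h)‖ < ‖h‖` for every nonzero `h`, where `P_F` takes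
the coefficient at the empty word. -/
def IsPurelyContractive (Θ : Fock n E →L[ℂ] Fock n F) : Prop :=
  ∀ h : E, h ≠ 0 → ‖(Θ (lp.single 2 [] h) : List (Fin n) → F) []‖ < ‖h‖

/-- `Θ` is a unitary constant: `Θ = I_Γ ⊗ U` for some unitary operator `U : E → F`. -/
def IsUnitaryConstant (Θ : Fock n E →L[ℂ] Fock n F) : Prop :=
  ∃ U : E ≃ₗᵢ[ℂ] F, ∀ (f : Fock n E) (α : List (Fin n)),
    (Θ f : List (Fin n) → F) α = U (f α)

end Fock

section Defect

variable {X Y : Type*} [NormedAddCommGroup X] [InnerProductSpace ℂ X] [CompleteSpace X]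
  [NormedAddCommGroup Y] [InnerProductSpace ℂ Y] [CompleteSpace Y]

/-- The defect operator `Δ_A = (I - A* A)^{1/2}` of a contraction `A`. -/
def defect (A : X →L[ℂ] Y) : X →L[ℂ] X :=
  CFC.sqrt (1 - A† ∘L A)

/-- The defect space, the closure of `Δ_A X`. -/
abbrev defectSpace (A : X →L[ℂ] Y) : Submodule ℂ X :=
  (LinearMap.range (defect A).toLinearMap).topologicalClosure

/-- The defect operator `Δ_A`, regarded as an operator into the defect space. -/
def defectMap (A : X →L[ℂ] Y) : X →L[ℂ] defectSpace A :=
  (defect A).codRestrict (defectSpace A)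
    fun x => Submodule.le_topologicalClosure _ (LinearMap.mem_range_self _ x)

/-- The subspace `G_A = {A w ⊕ Δ_A w}` of `Y ⊕ closure (Δ_A X)`. -/
def graphSpace (A : X →L[ℂ] Y) : Submodule ℂ (WithLp 2 (Y × defectSpace A)) :=
  LinearMap.range ((WithLp.linearEquiv 2 ℂ (Y × defectSpace A)).symm.toLinearMap ∘ₗ
    A.toLinearMap.prod (defectMap A).toLinearMap)

/-- The model space `H(A) = [Y ⊕ closure (Δ_A X)] ⊖ G_A`. -/
def modelSpace (A : X →L[ℂ] Y) : Submodule ℂ (WithLp 2 (Y × defectSpace A)) :=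
  (graphSpace A)ᗮ

theorem norm_defect_sq (A : X →L[ℂ] Y) (hA : ‖A‖ ≤ 1) (x : X) :
    ‖defect A x‖ ^ 2 = ‖x‖ ^ 2 - ‖A x‖ ^ 2 := by
  have hpos : (0 : X →L[ℂ] X) ≤ 1 - A† ∘L A := by
    rw [ContinuousLinearMap.nonneg_iff_isPositive]
    refine ⟨?_, fun y => ?_⟩
    · intro y z
      simp [inner_sub_left, inner_sub_right, ContinuousLinearMap.adjoint_inner_left,
        ContinuousLinearMap.adjoint_inner_right]
    · have h1 : ‖A y‖ ≤ ‖y‖ := A.le_of_opNorm_le_of_le hA le_rfl |>.trans (by simp)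
      have h2 : ‖A y‖ ^ 2 ≤ ‖y‖ ^ 2 := by gcongr
      simp only [ContinuousLinearMap.reApplyInnerSelf, sub_apply, inner_sub_left,
        ContinuousLinearMap.comp_apply, ContinuousLinearMap.adjoint_inner_left, map_sub,
        one_apply_eq_self, inner_self_eq_norm_sq]
      linarith
  have hsq : defect A * defect A = 1 - A† ∘L A := CFC.sqrt_mul_sqrt_self _ hpos
  have hsa : (defect A)† = defect A :=
    (CFC.sqrt_nonneg (1 - A† ∘L A)).isSelfAdjoint
  have h : ⟪defect A x, defect A x⟫_ℂ = ⟪x, x⟫_ℂ - ⟪A x, A x⟫_ℂ := by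
    calc ⟪defect A x, defect A x⟫_ℂ = ⟪((defect A)†) x, defect A x⟫_ℂ := by rw [hsa]
      _ = ⟪x, (defect A * defect A) x⟫_ℂ := by
        rw [ContinuousLinearMap.adjoint_inner_left]; rfl
      _ = _ := by
        rw [hsq]
        simp [ContinuousLinearMap.adjoint_inner_right]
  have h' := congrArg Complex.re h
  simpa [inner_self_eq_norm_sq_to_K, ← Complex.ofReal_pow] using h'

end Defect

section Factorization

variable {n : ℕ} {E : ℕ → Type*} [∀ i, NormedAddCommGroup (E i)]
  [∀ i, InnerProductSpace ℂ (E i)] [∀ i, CompleteSpace (E i)]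

/-- The Szegő condition: `Δ_Θ (Γ ⊗ E)` and `Δ_Θ ((Γ ⊗ E) ⊖ E)` have the same closure. Here
`(Γ ⊗ E) ⊖ E` consists of the families whose coefficient at the empty word vanishes. -/
def SzegoCondition {E F : Type*} [NormedAddCommGroup E] [InnerProductSpace ℂ E] [CompleteSpace E]
    [NormedAddCommGroup F] [InnerProductSpace ℂ F] [CompleteSpace F]
    (Θ : Fock n E →L[ℂ] Fock n F) : Prop :=
  closure (Set.range (defect Θ)) = closure (defect Θ '' {f | (f : List (Fin n) → E) [] = 0})

/-- For `a ≤ b` the product `θ_{b-1} ⋯ θ_a : Γ ⊗ E_a → Γ ⊗ E_b`; it is the identity if `a = b`. -/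
def prodFactors (θ : ∀ i, Fock n (E i) →L[ℂ] Fock n (E (i + 1))) {a b : ℕ} (hab : a ≤ b) :
    Fock n (E a) →L[ℂ] Fock n (E b) :=
  Nat.leRec (motive := fun m _ => Fock n (E a) →L[ℂ] Fock n (E m))
    (ContinuousLinearMap.id ℂ _) (fun m _ P => θ m ∘L P) hab

/-- The orthogonal direct sum of the defect spaces of `θ_1, …, θ_k`. -/
abbrev defectSum (k : ℕ) (θ : ∀ i, Fock n (E i) →L[ℂ] Fock n (E (i + 1))) : Type _ :=
  PiLp 2 (fun j : Finset.Icc 1 k => defectSpace (θ j))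

/-- `f ↦ Δ_k θ_{k-1} ⋯ θ_1 f ⊕ ⋯ ⊕ Δ_2 θ_1 f ⊕ Δ_1 f`; the component with index `j` is
`Δ_j θ_{j-1} ⋯ θ_1 f`. -/
def defectColumn (k : ℕ) (θ : ∀ i, Fock n (E i) →L[ℂ] Fock n (E (i + 1))) :
    Fock n (E 1) →ₗ[ℂ] defectSum k θ :=
  (WithLp.linearEquiv 2 ℂ (∀ j : Finset.Icc 1 k, defectSpace (θ j))).symm.toLinearMap ∘ₗ
    LinearMap.pi fun j : Finset.Icc 1 k =>
      (defectMap (θ j) ∘L prodFactors θ (Finset.mem_Icc.1 j.2).1).toLinearMap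

/-- The factorization of `θ_k ⋯ θ_1` is `k`-regular: the vectors
`Δ_k θ_{k-1} ⋯ θ_1 f ⊕ ⋯ ⊕ Δ_1 f` are dense in the direct sum of the defect spaces. -/
def IsRegularFactorization (k : ℕ) (θ : ∀ i, Fock n (E i) →L[ℂ] Fock n (E (i + 1))) : Prop :=
  closure (Set.range (defectColumn k θ)) = Set.univ

/-- The operator `Z_k` from the defect space of `Θ` to the direct sum of the defect spaces of
`θ_1, …, θ_k`, the continuous extension of
`Δ_Θ f ↦ Δ_k θ_{k-1} ⋯ θ_1 f ⊕ ⋯ ⊕ Δ_1 f`. -/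
def defectIsometry (k : ℕ) (θ : ∀ i, Fock n (E i) →L[ℂ] Fock n (E (i + 1)))
    (Θ : Fock n (E 1) →L[ℂ] Fock n (E (k + 1))) : defectSpace Θ →L[ℂ] defectSum k θ :=
  (defectColumn k θ).extendOfNorm (defectMap Θ).toLinearMap

theorem norm_defectColumn (k : ℕ) (θ : ∀ i, Fock n (E i) →L[ℂ] Fock n (E (i + 1)))
    (hθ : ∀ i, 1 ≤ i → i ≤ k → ‖θ i‖ ≤ 1) (f : Fock n (E 1)) :
    ‖defectColumn k θ f‖ ^ 2 =
      ‖f‖ ^ 2 - ‖prodFactors θ (Nat.le_add_left 1 k) f‖ ^ 2 := by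
  have hterm : ∀ j : Finset.Icc 1 k, ‖defectColumn k θ f j‖ ^ 2 =
      (fun m : ℕ => if h : 1 ≤ m then
        ‖prodFactors θ h f‖ ^ 2 - ‖prodFactors θ (Nat.le_succ_of_le h) f‖ ^ 2 else 0) j := by
    rintro ⟨j, hj⟩
    have hj' := Finset.mem_Icc.1 hj
    have h1 : ‖defectColumn k θ f ⟨j, hj⟩‖ = ‖defect (θ j) (prodFactors θ hj'.1 f)‖ := rfl
    have h2 : prodFactors θ (Nat.le_succ_of_le hj'.1) f = θ j (prodFactors θ hj'.1 f) := by
      unfold prodFactors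
      rw [Nat.leRec_succ _ _ hj'.1]
      rfl
    rw [h1, norm_defect_sq _ (hθ j hj'.1 hj'.2)]
    simp [hj'.1, h2]
  rw [PiLp.norm_sq_eq_of_L2, Finset.sum_congr rfl fun j _ => hterm j,
    Finset.sum_coe_sort (Finset.Icc 1 k) (fun m : ℕ => if h : 1 ≤ m then
        ‖prodFactors θ h f‖ ^ 2 - ‖prodFactors θ (Nat.le_succ_of_le h) f‖ ^ 2 else 0)]
  clear hterm hθ
  induction k with
  | zero => simp [prodFactors]
  | succ k ih =>
    rw [Finset.sum_Icc_succ_top (by omega), ih]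
    simp

/-- The defining property of `Z_k`: it is isometric and maps `Δ_Θ f` to
`Δ_k θ_{k-1} ⋯ θ_1 f ⊕ ⋯ ⊕ Δ_1 f`. -/
theorem defectIsometry_spec (k : ℕ) (θ : ∀ i, Fock n (E i) →L[ℂ] Fock n (E (i + 1)))
    (hθ : ∀ i, 1 ≤ i → i ≤ k → ‖θ i‖ ≤ 1) (Θ : Fock n (E 1) →L[ℂ] Fock n (E (k + 1)))
    (hΘ : ‖Θ‖ ≤ 1) (hfac : Θ = prodFactors θ (Nat.le_add_left 1 k)) :
    Isometry (defectIsometry k θ Θ) ∧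
      ∀ f, defectIsometry k θ Θ (defectMap Θ f) = defectColumn k θ f := by
  have hnorm : ∀ f, ‖defectColumn k θ f‖ = ‖defectMap Θ f‖ := by
    intro f
    have h1 : ‖defectMap Θ f‖ = ‖defect Θ f‖ := rfl
    rw [← pow_left_inj₀ (norm_nonneg _) (norm_nonneg _) two_ne_zero, h1, norm_defectColumn k θ hθ,
      norm_defect_sq _ hΘ, hfac]
  have hdense : DenseRange (defectMap Θ) := by
    rw [DenseRange, Subtype.dense_iff]
    intro x hx
    refine closure_mono ?_ hx
    rintro _ ⟨y, rfl⟩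
    exact ⟨defectMap Θ y, ⟨y, rfl⟩, rfl⟩
  have happ : ∀ f, defectIsometry k θ Θ (defectMap Θ f) = defectColumn k θ f := fun f =>
    LinearMap.extendOfNorm_eq (e := (defectMap Θ).toLinearMap) hdense
      ⟨1, fun x => by rw [one_mul]; exact (hnorm x).le⟩ f
  refine ⟨AddMonoidHomClass.isometry_of_norm _ fun x => ?_, happ⟩
  induction x using hdense.induction_on with
  | hp => exact isClosed_eq (by fun_prop) (by fun_prop)
  | ih f => rw [happ, hnorm]

/-- The subspace of all
`θ_k ⋯ θ_{i+1} u ⊕ Z_k* (Δ_k θ_{k-1} ⋯ θ_{i+1} u ⊕ ⋯ ⊕ Δ_{i+1} u ⊕ v_i ⊕ ⋯ ⊕ v_1)` with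
`u ∈ Γ ⊗ E_{i+1}` and `v_j` in the defect space of `θ_j` for `j = 1, …, i`. The family `w` below is
the argument of `Z_k*`; its components of index at most `i` are arbitrary. -/
def chainHull (k : ℕ) (θ : ∀ i, Fock n (E i) →L[ℂ] Fock n (E (i + 1)))
    (Θ : Fock n (E 1) →L[ℂ] Fock n (E (k + 1))) (i : ℕ) (hi : i ≤ k) :
    Submodule ℂ (WithLp 2 (Fock n (E (k + 1)) × defectSpace Θ)) where
  carrier := {p | ∃ (u : Fock n (E (i + 1))) (w : defectSum k θ),
    (∀ (j : Finset.Icc 1 k) (hj : i + 1 ≤ j), w j = defectMap (θ j) (prodFactors θ hj u)) ∧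
    p = WithLp.toLp 2
      (prodFactors θ (Nat.succ_le_succ hi) u, ((defectIsometry k θ Θ)†) w)}
  zero_mem' := ⟨0, 0, by simp, by rw [map_zero, map_zero]; rfl⟩
  add_mem' := by
    rintro _ _ ⟨u, w, hw, rfl⟩ ⟨u', w', hw', rfl⟩
    refine ⟨u + u', w + w', fun j hj => ?_, ?_⟩
    · simp [hw j hj, hw' j hj]
    · rw [map_add, map_add]; rfl
  smul_mem' := by
    rintro c _ ⟨u, w, hw, rfl⟩
    refine ⟨c • u, c • w, fun j hj => ?_, ?_⟩
    · simp [hw j hj]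
    · rw [map_smul, map_smul]; rfl

/-- The `i`-th subspace `M_i` of the model space `H(Θ)` in the chain that corresponds to the
factorization `Θ = θ_k ⋯ θ_1`: the orthogonal difference of `chainHull` and `G_Θ`. -/
def chainSubspace (k : ℕ) (θ : ∀ i, Fock n (E i) →L[ℂ] Fock n (E (i + 1)))
    (Θ : Fock n (E 1) →L[ℂ] Fock n (E (k + 1))) (i : ℕ) (hi : i ≤ k) :
    Submodule ℂ (WithLp 2 (Fock n (E (k + 1)) × defectSpace Θ)) :=
  chainHull k θ Θ i hi ⊓ modelSpace Θ

end Factorization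

end RegularFactorization

end

open RegularFactorization

/-!
Write `L_i` for `chainHull k θ Θ i`, so that `M_i = L_i ⊖ G_Θ`. Since `G_Θ` is closed and contained
in `L_i`, the equality `M_i = M_{i+1}` is equivalent to `L_i = L_{i+1}` (`chainSubspace_eq_iff`).

By regularity `Z_k*` is injective, and a vector `y ∈ Γ ⊗ E_{i+2}` is determined by `θ_k ⋯ θ_{i+2} y`
together with its defect components. Hence `L_i = L_{i+1}` forces the isometry `u ↦ T u ⊕ Δ_T u`,
with `T = θ_{i+1}`, to be onto the sum of `Γ ⊗ E_{i+2}` and the defect space of `T`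
(`graph_surjective_of_chainHull_eq`). For such a contraction `T T* = 1` and `Δ_T = 1 - T* T` is the
projection onto the kernel of `T`; comparing norms, `T*` commutes with the creation operators, and
therefore so does `Δ_T` (`defect_intertwines_of_graph_surjective`).

The Szegő condition then excludes a nonzero `Δ_T`. Transported by `Z_k`, it says that the vectors
`Δ_T θ_i ⋯ θ_1 f`, with `f` running over the families without constant coefficient, are dense in the
defect space of `T`; all operators involved preserve the vanishing of the constant coefficient, so
every vector of the defect space has none (`defect_apply_nil_eq_zero_of_szego`). The projection `Δ_T`
thus kills the constants, and, commuting with the creation operators, it is zero. So `T` is unitary,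
and as `T` and `T*` are both multi-analytic, `T` maps constants onto constants and is of the form
`I ⊗ U` (`isUnitaryConstant_of_intertwines`).

Conversely, a unitary constant is onto and has zero defect, and replacing `u` by `T u` identifies the
two hulls (`chainHull_succ_le_of_isUnitaryConstant`).
-/

namespace RegularFactorization

/-! ### Operators intertwining the creation operators -/

section Fock

variable {n : ℕ} {E F : Type*} [NormedAddCommGroup E] [InnerProductSpace ℂ E]
  [NormedAddCommGroup F] [InnerProductSpace ℂ F]

theorem creation_single (j : Fin n) (β : List (Fin n)) (h : E) :
    creation j (lp.single 2 β h : Fock n E) = lp.single 2 (j :: β) h := by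
  ext α
  change creationFun j (lp.single 2 β h : Fock n E) α = _
  rcases α with _ | ⟨i, γ⟩
  · simp [creationFun]
  · by_cases hij : i = j
    · subst hij
      by_cases hγ : γ = β
      · subst hγ
        simp [creationFun]
      · have h2 : i :: γ ≠ i :: β := by simpa using hγ
        simp [creationFun, hγ, h2]
    · have h2 : i :: γ ≠ j :: β := by simp [hij]
      simp [creationFun, hij, h2]

theorem creation_apply_nil (j : Fin n) (f : Fock n E) :
    (creation j f : List (Fin n) → E) [] = 0 := rfl

/-- A bounded operator on a Fock space is determined by its values on the vectors `e_α ⊗ h`. -/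
theorem Fock.ext_single {T T' : Fock n E →L[ℂ] Fock n F}
    (h : ∀ (α : List (Fin n)) (x : E), T (lp.single 2 α x) = T' (lp.single 2 α x)) : T = T' := by
  refine lp.ext_continuousLinearMap (by norm_num) fun α => ?_
  ext1 x
  exact h α x

/-- An intertwiner of the creation operators is determined by its values on the constants. -/
theorem eq_of_intertwines {T T' : Fock n E →L[ℂ] Fock n F}
    (hT : ∀ j f, T (creation j f) = creation j (T f))
    (hT' : ∀ j f, T' (creation j f) = creation j (T' f))
    (h : ∀ x : E, T (lp.single 2 [] x) = T' (lp.single 2 [] x)) : T = T' := by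
  refine Fock.ext_single fun α x => ?_
  induction α with
  | nil => exact h x
  | cons j β ih => rw [← creation_single, hT, hT', ih]

/-- An intertwiner of the creation operators maps `(Γ ⊗ E) ⊖ E`, the closed span of the ranges of
the creation operators, into `(Γ ⊗ F) ⊖ F`. -/
theorem apply_nil_eq_zero_of_intertwines {T : Fock n E →L[ℂ] Fock n F}
    (hT : ∀ j f, T (creation j f) = creation j (T f)) {f : Fock n E}
    (hf : (f : List (Fin n) → E) [] = 0) : (T f : List (Fin n) → F) [] = 0 := by
  have h1 := ((lp.hasSum_single (p := 2) (by norm_num) f).mapL T).mapL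
    (lp.evalCLM ℂ (fun _ : List (Fin n) => F) 2 [])
  refine h1.unique ?_
  convert hasSum_zero with α
  rcases α with _ | ⟨j, β⟩
  · rw [hf]; simp
  · rw [← creation_single, hT]
    exact creation_apply_nil j (T (lp.single 2 β (f (j :: β))))

/-- A vector of the Fock space orthogonal to `(Γ ⊗ F) ⊖ F` is a constant. -/
theorem eq_single_nil_of_orthogonal {f : Fock n F}
    (hf : ∀ g : Fock n F, (g : List (Fin n) → F) [] = 0 → ⟪f, g⟫_ℂ = 0) :
    f = lp.single 2 [] ((f : List (Fin n) → F) []) := by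
  rw [← sub_eq_zero]
  set c : Fock n F := lp.single 2 [] ((f : List (Fin n) → F) []) with hc
  have h0 : ((f - c : Fock n F) : List (Fin n) → F) [] = 0 := by simp [hc]
  have h1 : ⟪f - c, f - c⟫_ℂ = 0 := by
    rw [inner_sub_left, hf _ h0, hc, lp.inner_single_left, ← hc, h0]
    simp
  exact inner_self_eq_zero.1 h1

theorem IsUnitaryConstant.norm_apply {T : Fock n E →L[ℂ] Fock n F} (hT : IsUnitaryConstant T)
    (f : Fock n E) : ‖T f‖ = ‖f‖ := by
  obtain ⟨U, hU⟩ := hT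
  rw [← pow_left_inj₀ (norm_nonneg _) (norm_nonneg _) two_ne_zero]
  have h1 := lp.hasSum_norm (p := 2) (by norm_num) (T f)
  have h2 := lp.hasSum_norm (p := 2) (by norm_num) f
  simp only [hU, LinearIsometryEquiv.norm_map] at h1
  simpa using h1.unique h2

theorem IsUnitaryConstant.surjective {T : Fock n E →L[ℂ] Fock n F} (hT : IsUnitaryConstant T) :
    Function.Surjective T := by
  obtain ⟨U, hU⟩ := hT
  intro g
  refine ⟨⟨fun α => U.symm (g α), ?_⟩, ?_⟩
  · refine memℓp_gen ?_
    simpa using (lp.hasSum_norm (p := 2) (by norm_num) g).summable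
  · ext α
    rw [hU]
    exact U.apply_symm_apply _

variable [CompleteSpace E] [CompleteSpace F]

/-- If the adjoint also intertwines the creation operators, constants are mapped to constants. -/
theorem apply_single_nil_of_adjoint_intertwines {T : Fock n E →L[ℂ] Fock n F}
    (hT' : ∀ j f, (T†) (creation j f) = creation j ((T†) f)) (x : E) :
    T (lp.single 2 [] x) =
      lp.single 2 [] ((T (lp.single 2 [] x) : List (Fin n) → F) []) := by
  refine eq_single_nil_of_orthogonal fun g hg => ?_
  rw [← ContinuousLinearMap.adjoint_inner_right, lp.inner_single_left,
    apply_nil_eq_zero_of_intertwines hT' hg, inner_zero_right]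

/-- A unitary operator which, together with its adjoint, intertwines the creation operators is a
unitary constant. -/
theorem isUnitaryConstant_of_intertwines {T : Fock n E →L[ℂ] Fock n F}
    (hT : ∀ j f, T (creation j f) = creation j (T f))
    (hT' : ∀ j f, (T†) (creation j f) = creation j ((T†) f))
    (hiso : ∀ f, ‖T f‖ = ‖f‖) (hco : ∀ g, T ((T†) g) = g) : IsUnitaryConstant T := by
  let U₀ : E →L[ℂ] F := lp.evalCLM ℂ (fun _ : List (Fin n) => F) 2 [] ∘L T ∘L
    lp.singleContinuousLinearMap ℂ (fun _ : List (Fin n) => E) 2 []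
  have hU (x : E) : T (lp.single 2 [] x) = lp.single 2 [] (U₀ x) :=
    apply_single_nil_of_adjoint_intertwines hT' x
  have hnorm (x : E) : ‖U₀ x‖ = ‖x‖ := by
    rw [← lp.norm_single (E := fun _ : List (Fin n) => F) (p := 2) (by norm_num) [] (U₀ x),
      ← hU, hiso, lp.norm_single (by norm_num)]
  have hsurj : Function.Surjective U₀ := by
    intro y
    have h1 := apply_single_nil_of_adjoint_intertwines (T := T†)
      (by simpa using hT) y
    refine ⟨((T†) (lp.single 2 [] y) : List (Fin n) → E) [], ?_⟩
    have h2 := hU (((T†) (lp.single 2 [] y) : List (Fin n) → E) [])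
    rw [← h1, hco] at h2
    simpa using (congrArg (fun f : Fock n F => (f : List (Fin n) → F) []) h2).symm
  refine ⟨LinearIsometryEquiv.ofSurjective ⟨U₀.toLinearMap, hnorm⟩ hsurj, fun f α => ?_⟩
  have hsingle (β : List (Fin n)) (x : E) : T (lp.single 2 β x) = lp.single 2 β (U₀ x) := by
    induction β with
    | nil => exact hU x
    | cons j β ih => rw [← creation_single, hT, ih, creation_single]
  have hcomp : lp.evalCLM ℂ (fun _ : List (Fin n) => F) 2 α ∘L T =
      U₀ ∘L lp.evalCLM ℂ (fun _ : List (Fin n) => E) 2 α := by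
    refine lp.ext_continuousLinearMap (by norm_num) fun β => ?_
    ext1 x
    change (T (lp.single 2 β x) : List (Fin n) → F) α =
      U₀ ((lp.single 2 β x : Fock n E) α)
    rw [hsingle]
    by_cases hαβ : α = β
    · subst hαβ; simp
    · simp [hαβ]
  exact congrArg (fun L : Fock n E →L[ℂ] F => L f) hcomp

end Fock

/-! ### Defect operators and the surjectivity of the graph map -/

section Defect

variable {X Y : Type*} [NormedAddCommGroup X] [InnerProductSpace ℂ X] [CompleteSpace X]
  [NormedAddCommGroup Y] [InnerProductSpace ℂ Y] [CompleteSpace Y]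

theorem defect_nonneg (A : X →L[ℂ] Y) : 0 ≤ defect A := CFC.sqrt_nonneg _

theorem defect_defect_apply {A : X →L[ℂ] Y} (hA : ‖A‖ ≤ 1) (x : X) :
    defect A (defect A x) = x - (A†) (A x) := by
  have hpos : (0 : X →L[ℂ] X) ≤ 1 - A† ∘L A := by
    rw [ContinuousLinearMap.nonneg_iff_isPositive]
    refine ⟨fun y z => by simp [inner_sub_left, inner_sub_right,
      ContinuousLinearMap.adjoint_inner_left, ContinuousLinearMap.adjoint_inner_right],
      fun y => ?_⟩
    have h1 : ‖A y‖ ≤ ‖y‖ := A.le_of_opNorm_le_of_le hA le_rfl |>.trans (by simp)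
    have h2 : ‖A y‖ ^ 2 ≤ ‖y‖ ^ 2 := by gcongr
    simp only [ContinuousLinearMap.reApplyInnerSelf, sub_apply, inner_sub_left,
      ContinuousLinearMap.comp_apply, ContinuousLinearMap.adjoint_inner_left, map_sub,
      one_apply_eq_self, inner_self_eq_norm_sq]
    linarith
  have h : defect A * defect A = 1 - A† ∘L A := CFC.sqrt_mul_sqrt_self _ hpos
  exact congrArg (fun L : X →L[ℂ] X => L x) h

/-- Equality in the contraction inequality. -/
theorem adjoint_apply_apply_of_norm_eq {A : X →L[ℂ] Y} (hA : ‖A‖ ≤ 1) {x : X}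
    (hx : ‖A x‖ = ‖x‖) : (A†) (A x) = x := by
  have h := norm_defect_sq A hA x
  rw [hx, sub_self, sq_eq_zero_iff, norm_eq_zero] at h
  have h2 := defect_defect_apply hA x
  rw [h, map_zero] at h2
  exact (sub_eq_zero.1 h2.symm).symm

/-- A positive operator `Δ` with `Δ² x = x` fixes `x`, because `Δ + 1` is injective. -/
theorem defect_apply_of_apply_eq_zero {A : X →L[ℂ] Y} (hA : ‖A‖ ≤ 1) {x : X} (hx : A x = 0) :
    defect A x = x := by
  have h := defect_defect_apply hA x
  rw [hx, map_zero, sub_zero] at h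
  have hpos :=
    ((ContinuousLinearMap.nonneg_iff_isPositive _).1 (defect_nonneg A)).re_inner_nonneg_left
      (defect A x - x)
  have h2 : defect A (defect A x - x) = -(defect A x - x) := by rw [map_sub, h]; abel
  rw [h2, inner_neg_left, map_neg, inner_self_eq_norm_sq] at hpos
  have h3 : ‖defect A x - x‖ = 0 := by nlinarith [norm_nonneg (defect A x - x)]
  exact sub_eq_zero.1 (norm_eq_zero.1 h3)

theorem denseRange_defectMap (A : X →L[ℂ] Y) : DenseRange (defectMap A) := by
  rw [DenseRange, Subtype.dense_iff]
  intro x hx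
  refine closure_mono ?_ hx
  rintro _ ⟨y, rfl⟩
  exact ⟨defectMap A y, ⟨y, rfl⟩, rfl⟩

/-- If `x ↦ A x ⊕ Δ_A x` is onto, then `Δ_A` is the orthogonal projection onto the kernel of `A`,
here in the form `Δ_A = 1 - A* A`. -/
theorem defect_eq_of_graph_surjective {A : X →L[ℂ] Y} (hA : ‖A‖ ≤ 1)
    (hs : ∀ (y : Y) (d : defectSpace A), ∃ x, A x = y ∧ defectMap A x = d) (x : X) :
    defect A x = x - (A†) (A x) := by
  obtain ⟨z, hz, hd⟩ := hs 0 (defectMap A x)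
  have h1 : defect A z = defect A x := congrArg Subtype.val hd
  rw [← defect_defect_apply hA, ← h1, defect_apply_of_apply_eq_zero hA hz,
    defect_apply_of_apply_eq_zero hA hz]

/-- If `x ↦ A x ⊕ Δ_A x` is onto, then `A` is a coisometry. -/
theorem apply_adjoint_apply_of_graph_surjective {A : X →L[ℂ] Y} (hA : ‖A‖ ≤ 1)
    (hs : ∀ (y : Y) (d : defectSpace A), ∃ x, A x = y ∧ defectMap A x = d) (y : Y) :
    A ((A†) y) = y := by
  obtain ⟨x, rfl, hx⟩ := hs y 0
  have h1 : defect A x = 0 := congrArg Subtype.val hx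
  have h2 := defect_eq_of_graph_surjective hA hs x
  rw [h1] at h2
  rw [← sub_eq_zero.1 h2.symm]

theorem graphSpace_isClosed {A : X →L[ℂ] Y} (hA : ‖A‖ ≤ 1) :
    IsClosed (graphSpace A : Set (WithLp 2 (Y × defectSpace A))) := by
  let L : X →ₗᵢ[ℂ] WithLp 2 (Y × defectSpace A) :=
    ⟨(WithLp.linearEquiv 2 ℂ (Y × defectSpace A)).symm.toLinearMap ∘ₗ
      A.toLinearMap.prod (defectMap A).toLinearMap, fun x => by
      rw [← pow_left_inj₀ (norm_nonneg _) (norm_nonneg _) two_ne_zero,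
        WithLp.prod_norm_sq_eq_of_L2]
      change ‖A x‖ ^ 2 + ‖defect A x‖ ^ 2 = _
      rw [norm_defect_sq A hA]
      ring⟩
  have : (graphSpace A : Set (WithLp 2 (Y × defectSpace A))) = Set.range L := rfl
  rw [this]
  exact L.isometry.isClosedEmbedding.isClosed_range

end Defect

/-! ### Multi-analytic operators with surjective graph map -/

section MultiAnalytic

variable {n : ℕ} {E F : Type*} [NormedAddCommGroup E] [InnerProductSpace ℂ E] [CompleteSpace E]
  [NormedAddCommGroup F] [InnerProductSpace ℂ F] [CompleteSpace F]

/-- The adjoint of a coisometric multi-analytic contraction `T` is multi-analytic: `S_j T* g` has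
the same norm as its image `S_j g` under `T`, hence lies in the range of `T*`. -/
theorem adjoint_intertwines_of_coisometry {T : Fock n E →L[ℂ] Fock n F}
    (hT : IsContractiveMultiAnalytic T) (hco : ∀ g, T ((T†) g) = g) (j : Fin n) (g : Fock n F) :
    (T†) (creation j g) = creation j ((T†) g) := by
  have h1 : T (creation j ((T†) g)) = creation j g := by rw [hT.intertwines, hco]
  have h2 : ‖(T†) g‖ = ‖g‖ := by
    have : (T†)† ∘L T† = 1 := by ext1 y; simpa using hco y
    exact ((T†).norm_map_iff_adjoint_comp_self).2 this g
  have h3 := adjoint_apply_apply_of_norm_eq hT.contractive (x := creation j ((T†) g))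
    (by rw [h1, LinearIsometry.norm_map, LinearIsometry.norm_map, h2])
  rwa [h1] at h3

/-- If `x ↦ T x ⊕ Δ_T x` is onto, then `Δ_T = 1 - T* T` is built from operators intertwining the
creation operators, and so intertwines them too. -/
theorem defect_intertwines_of_graph_surjective {T : Fock n E →L[ℂ] Fock n F}
    (hT : IsContractiveMultiAnalytic T)
    (hs : ∀ (y : Fock n F) (d : defectSpace T), ∃ x, T x = y ∧ defectMap T x = d) (j : Fin n)
    (f : Fock n E) : defect T (creation j f) = creation j (defect T f) := by
  have hdef := defect_eq_of_graph_surjective hT.contractive hs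
  rw [hdef, hdef, hT.intertwines, adjoint_intertwines_of_coisometry hT
    (apply_adjoint_apply_of_graph_surjective hT.contractive hs), map_sub]

/-- A multi-analytic contraction `T` for which `x ↦ T x ⊕ Δ_T x` is onto has a multi-analytic
defect projection `Δ_T`. If moreover the values of `Δ_T` have vanishing constant coefficient, then
`‖Δ_T (e_∅ ⊗ x)‖² = ⟪e_∅ ⊗ x, Δ_T (e_∅ ⊗ x)⟫ = 0`, so the defect vanishes and `T` is a unitary
constant. -/
theorem isUnitaryConstant_of_graph_surjective {T : Fock n E →L[ℂ] Fock n F}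
    (hT : IsContractiveMultiAnalytic T)
    (hs : ∀ (y : Fock n F) (d : defectSpace T), ∃ x, T x = y ∧ defectMap T x = d)
    (h0 : ∀ f, (defect T f : List (Fin n) → E) [] = 0) : IsUnitaryConstant T := by
  have hco := apply_adjoint_apply_of_graph_surjective hT.contractive hs
  have hT' := adjoint_intertwines_of_coisometry hT hco
  have hdef := defect_eq_of_graph_surjective hT.contractive hs
  have hzero : defect T = 0 := by
    refine eq_of_intertwines (fun j f => ?_) (fun j f => ?_) fun x => ?_
    · exact defect_intertwines_of_graph_surjective hT hs j f
    · simp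
    · have hsa : (defect T)† = defect T := (defect_nonneg T).isSelfAdjoint
      have hidem (f : Fock n E) : defect T (defect T f) = defect T f := by
        rw [defect_defect_apply hT.contractive, hdef]
      have : ⟪defect T (lp.single 2 [] x), defect T (lp.single 2 [] x)⟫_ℂ = 0 := by
        rw [← ContinuousLinearMap.adjoint_inner_right, hsa, hidem, lp.inner_single_left, h0,
          inner_zero_right]
      simpa using this
  refine isUnitaryConstant_of_intertwines hT.intertwines hT' (fun f => ?_) hco
  have h := norm_defect_sq T hT.contractive f
  rw [hzero, zero_apply, norm_zero] at h
  rw [← pow_left_inj₀ (norm_nonneg _) (norm_nonneg _) two_ne_zero]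
  linarith

end MultiAnalytic

/-! ### Regular factorizations and the chain of subspaces -/

section Factorization

variable {n : ℕ} {E : ℕ → Type*} [∀ i, NormedAddCommGroup (E i)]
  [∀ i, InnerProductSpace ℂ (E i)]

theorem prodFactors_self (θ : ∀ i, Fock n (E i) →L[ℂ] Fock n (E (i + 1))) (a : ℕ) :
    prodFactors θ (le_refl a) = ContinuousLinearMap.id ℂ _ := by
  unfold prodFactors
  rw [Nat.leRec_self]

theorem prodFactors_succ (θ : ∀ i, Fock n (E i) →L[ℂ] Fock n (E (i + 1))) {a b : ℕ}
    (hab : a ≤ b) (hab' : a ≤ b + 1) : prodFactors θ hab' = θ b ∘L prodFactors θ hab := by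
  unfold prodFactors
  rw [Nat.leRec_succ _ _ hab]

theorem prodFactors_succ_left (θ : ∀ i, Fock n (E i) →L[ℂ] Fock n (E (i + 1))) {a b : ℕ}
    (hab : a ≤ b) (hab' : a + 1 ≤ b) (f : Fock n (E a)) :
    prodFactors θ hab f = prodFactors θ hab' (θ a f) := by
  induction b, hab' using Nat.le_induction with
  | base => rw [prodFactors_succ θ le_rfl, prodFactors_self, prodFactors_self]; rfl
  | succ b hb ih =>
    rw [prodFactors_succ θ (by omega : a ≤ b), prodFactors_succ θ hb,
      ContinuousLinearMap.comp_apply, ContinuousLinearMap.comp_apply, ih]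

theorem prodFactors_trans (θ : ∀ i, Fock n (E i) →L[ℂ] Fock n (E (i + 1))) {a b c : ℕ}
    (hab : a ≤ b) (hbc : b ≤ c) (hac : a ≤ c) (f : Fock n (E a)) :
    prodFactors θ hac f = prodFactors θ hbc (prodFactors θ hab f) := by
  induction c, hbc using Nat.le_induction with
  | base => rw [prodFactors_self]; rfl
  | succ c hc ih =>
    rw [prodFactors_succ θ (hab.trans hc), prodFactors_succ θ hc,
      ContinuousLinearMap.comp_apply, ContinuousLinearMap.comp_apply, ih]

theorem prodFactors_intertwines (θ : ∀ i, Fock n (E i) →L[ℂ] Fock n (E (i + 1))) {a b : ℕ}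
    (hab : a ≤ b) (hθ : ∀ i, a ≤ i → i < b → IsContractiveMultiAnalytic (θ i)) (j : Fin n)
    (f : Fock n (E a)) :
    prodFactors θ hab (creation j f) = creation j (prodFactors θ hab f) := by
  induction b, hab using Nat.le_induction with
  | base => simp [prodFactors_self]
  | succ b hb ih =>
    rw [prodFactors_succ θ hb, ContinuousLinearMap.comp_apply, ContinuousLinearMap.comp_apply,
      ih fun i h1 h2 => hθ i h1 (by omega), (hθ b hb (by omega)).intertwines]

variable [∀ i, CompleteSpace (E i)]

/-- `Z_k` is onto: its range is closed and contains the dense set of defect columns. -/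
theorem defectIsometry_surjective {k : ℕ} {θ : ∀ i, Fock n (E i) →L[ℂ] Fock n (E (i + 1))}
    (hθ : ∀ i, 1 ≤ i → i ≤ k → ‖θ i‖ ≤ 1) {Θ : Fock n (E 1) →L[ℂ] Fock n (E (k + 1))}
    (hΘ : ‖Θ‖ ≤ 1) (hfac : Θ = prodFactors θ (Nat.le_add_left 1 k))
    (hreg : IsRegularFactorization k θ) : Function.Surjective (defectIsometry k θ Θ) := by
  obtain ⟨hiso, happ⟩ := defectIsometry_spec k θ hθ Θ hΘ hfac
  rw [← Set.range_eq_univ, ← hiso.isClosedEmbedding.isClosed_range.closure_eq,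
    Set.eq_univ_iff_forall]
  have hsub : Set.range (defectColumn k θ) ⊆ Set.range (defectIsometry k θ Θ) := by
    rintro _ ⟨f, rfl⟩
    exact ⟨defectMap Θ f, happ f⟩
  exact fun w => closure_mono hsub (hreg.symm ▸ Set.mem_univ w)

/-- The Szegő condition is transported by `Z_k`: if `Δ_m` maps `(Γ ⊗ E_m) ⊖ E_m` into itself, then
the whole defect space of `θ_m` consists of families without constant coefficient. -/
theorem defect_apply_nil_eq_zero_of_szego {k : ℕ}
    {θ : ∀ i, Fock n (E i) →L[ℂ] Fock n (E (i + 1))}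
    (hθ : ∀ i, 1 ≤ i → i ≤ k → IsContractiveMultiAnalytic (θ i))
    {Θ : Fock n (E 1) →L[ℂ] Fock n (E (k + 1))} (hΘ : ‖Θ‖ ≤ 1)
    (hfac : Θ = prodFactors θ (Nat.le_add_left 1 k)) (hreg : IsRegularFactorization k θ)
    (hszego : SzegoCondition Θ) {m : ℕ} (hm : 1 ≤ m) (hmk : m ≤ k)
    (hpres : ∀ f : Fock n (E m), (f : List (Fin n) → E m) [] = 0 →
      (defect (θ m) f : List (Fin n) → E m) [] = 0) (f : Fock n (E m)) :
    (defect (θ m) f : List (Fin n) → E m) [] = 0 := by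
  obtain ⟨hiso, happ⟩ :=
    defectIsometry_spec k θ (fun i h1 h2 => (hθ i h1 h2).contractive) Θ hΘ hfac
  let m' : Finset.Icc 1 k := ⟨m, Finset.mem_Icc.2 ⟨hm, hmk⟩⟩
  let C : Set (defectSum k θ) :=
    {w | lp.evalCLM ℂ (fun _ : List (Fin n) => E m) 2 [] (w m' : Fock n (E m)) = 0}
  have hC : IsClosed C := by
    refine isClosed_eq ?_ continuous_const
    exact (ContinuousLinearMap.continuous _).comp
      (continuous_subtype_val.comp (PiLp.continuous_apply 2 _ m'))
  have hCΘ : IsClosed (defectIsometry k θ Θ ⁻¹' C) := hC.preimage hiso.continuous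
  have hcol (x : Fock n (E 1)) : defectColumn k θ x ∈ C := by
    have hx : defectMap Θ x ∈ closure (defectMap Θ '' {f | (f : List (Fin n) → E 1) [] = 0}) := by
      rw [closure_subtype, Set.image_image]
      change defect Θ x ∈ closure (defect Θ '' {f | (f : List (Fin n) → E 1) [] = 0})
      rw [← hszego]
      exact subset_closure ⟨x, rfl⟩
    rw [← happ]
    refine (hCΘ.closure_subset_iff.2 ?_) hx
    rintro _ ⟨f, hf, rfl⟩
    rw [Set.mem_preimage, happ]
    refine hpres _ (apply_nil_eq_zero_of_intertwines
      (prodFactors_intertwines θ hm fun i h1 h2 => hθ i h1 (by omega)) hf)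
  have hall : ∀ w, w ∈ C := fun w => by
    refine (hC.closure_subset_iff.2 ?_) (hreg.symm ▸ Set.mem_univ w :
      w ∈ closure (Set.range (defectColumn k θ)))
    rintro _ ⟨x, rfl⟩
    exact hcol x
  have h := hall (PiLp.single 2 m' (defectMap (θ m) f))
  have h' : (PiLp.single 2 m' (defectMap (θ m) f) : defectSum k θ) m' = defectMap (θ m) f := by
    simp
  change lp.evalCLM ℂ (fun _ : List (Fin n) => E m) 2 []
    ((PiLp.single 2 m' (defectMap (θ m) f) : defectSum k θ) m' : Fock n (E m)) = 0 at h
  rw [h'] at h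
  exact h

/-- As `Z_k` is onto, `Z_k*` is injective, so an element of `chainHull` determines the family `w`
that parametrises it. -/
theorem defectIsometry_adjoint_injective {k : ℕ}
    {θ : ∀ i, Fock n (E i) →L[ℂ] Fock n (E (i + 1))}
    (hθ : ∀ i, 1 ≤ i → i ≤ k → ‖θ i‖ ≤ 1) {Θ : Fock n (E 1) →L[ℂ] Fock n (E (k + 1))}
    (hΘ : ‖Θ‖ ≤ 1) (hfac : Θ = prodFactors θ (Nat.le_add_left 1 k))
    (hreg : IsRegularFactorization k θ) : Function.Injective ((defectIsometry k θ Θ)†) := by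
  intro w w' h
  obtain ⟨x, hx⟩ := defectIsometry_surjective hθ hΘ hfac hreg (w - w')
  have h1 : ⟪w - w', w - w'⟫_ℂ = 0 := by
    nth_rw 2 [← hx]
    rw [← ContinuousLinearMap.adjoint_inner_left, map_sub, h, sub_self, inner_zero_left]
  exact sub_eq_zero.1 (inner_self_eq_zero.1 h1)

/-- A vector with vanishing product and vanishing defect components is zero: this is the
injectivity of the isometry `x ↦ θ_{b-1} ⋯ θ_a x ⊕ Δ_{b-1} θ_{b-2} ⋯ θ_a x ⊕ ⋯ ⊕ Δ_a x`. -/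
theorem eq_zero_of_prodFactors_eq_zero {θ : ∀ i, Fock n (E i) →L[ℂ] Fock n (E (i + 1))} {a b : ℕ}
    (hab : a ≤ b) (hθ : ∀ j, a ≤ j → j < b → ‖θ j‖ ≤ 1) {x : Fock n (E a)}
    (hx : prodFactors θ hab x = 0)
    (hd : ∀ j (hj : a ≤ j), j < b → defectMap (θ j) (prodFactors θ hj x) = 0) : x = 0 := by
  induction b, hab using Nat.le_induction with
  | base => simpa [prodFactors_self] using hx
  | succ b hb ih =>
    refine ih (fun j h1 h2 => hθ j h1 (by omega)) ?_ fun j h1 h2 => hd j h1 (by omega)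
    have h1 : defect (θ b) (prodFactors θ hb x) = 0 :=
      congrArg Subtype.val (hd b hb (by omega))
    have h2 : θ b (prodFactors θ hb x) = 0 := by
      rwa [prodFactors_succ θ hb] at hx
    have h3 := norm_defect_sq (θ b) (hθ b hb (by omega)) (prodFactors θ hb x)
    rw [h1, h2] at h3
    simpa using h3.symm

theorem graphSpace_le_chainHull {k : ℕ} {θ : ∀ i, Fock n (E i) →L[ℂ] Fock n (E (i + 1))}
    (hθ : ∀ i, 1 ≤ i → i ≤ k → ‖θ i‖ ≤ 1) {Θ : Fock n (E 1) →L[ℂ] Fock n (E (k + 1))}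
    (hΘ : ‖Θ‖ ≤ 1) (hfac : Θ = prodFactors θ (Nat.le_add_left 1 k)) (i : ℕ) (hi : i ≤ k) :
    graphSpace Θ ≤ chainHull k θ Θ i hi := by
  obtain ⟨hiso, happ⟩ := defectIsometry_spec k θ hθ Θ hΘ hfac
  have hZ : (defectIsometry k θ Θ)† ∘L defectIsometry k θ Θ = 1 :=
    (defectIsometry k θ Θ).norm_map_iff_adjoint_comp_self.1
      ((AddMonoidHomClass.isometry_iff_norm _).1 hiso)
  rintro _ ⟨f, rfl⟩
  refine ⟨prodFactors θ (Nat.le_add_left 1 i) f, defectColumn k θ f, fun j hj => ?_, ?_⟩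
  · rw [← prodFactors_trans θ _ hj (Finset.mem_Icc.1 j.2).1]
    rfl
  · rw [← prodFactors_trans θ _ _ (Nat.le_add_left 1 k), ← hfac, ← happ]
    have h := congrArg (fun L : defectSpace Θ →L[ℂ] defectSpace Θ => L (defectMap Θ f)) hZ
    change ((defectIsometry k θ Θ)†) (defectIsometry k θ Θ (defectMap Θ f)) = defectMap Θ f at h
    rw [h]
    rfl

/-- The graph space is closed and contained in every `chainHull`, so it may be split off. -/
theorem chainSubspace_eq_iff {k : ℕ} {θ : ∀ i, Fock n (E i) →L[ℂ] Fock n (E (i + 1))}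
    (hθ : ∀ i, 1 ≤ i → i ≤ k → ‖θ i‖ ≤ 1) {Θ : Fock n (E 1) →L[ℂ] Fock n (E (k + 1))}
    (hΘ : ‖Θ‖ ≤ 1) (hfac : Θ = prodFactors θ (Nat.le_add_left 1 k)) {i j : ℕ} (hi : i ≤ k)
    (hj : j ≤ k) : chainSubspace k θ Θ i hi = chainSubspace k θ Θ j hj ↔
      chainHull k θ Θ i hi = chainHull k θ Θ j hj := by
  refine ⟨fun h => ?_, fun h => by rw [chainSubspace, chainSubspace, h]⟩
  have : CompleteSpace (graphSpace Θ) := (graphSpace_isClosed hΘ).completeSpace_coe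
  unfold chainSubspace modelSpace at h
  rw [← Submodule.sup_orthogonal_inf_of_hasOrthogonalProjection
      (graphSpace_le_chainHull hθ hΘ hfac i hi), inf_comm, h, inf_comm,
    Submodule.sup_orthogonal_inf_of_hasOrthogonalProjection
      (graphSpace_le_chainHull hθ hΘ hfac j hj)]

theorem chainHull_le_succ {k : ℕ} (θ : ∀ i, Fock n (E i) →L[ℂ] Fock n (E (i + 1)))
    (Θ : Fock n (E 1) →L[ℂ] Fock n (E (k + 1))) {i : ℕ} (hi : i ≤ k) (hi' : i + 1 ≤ k) :
    chainHull k θ Θ i hi ≤ chainHull k θ Θ (i + 1) hi' := by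
  rintro _ ⟨u, w, hw, rfl⟩
  refine ⟨θ (i + 1) u, w, fun j hj => ?_, ?_⟩
  · rw [hw j (by omega), prodFactors_succ_left θ _ hj]
  · rw [prodFactors_succ_left θ _ (Nat.succ_le_succ hi')]

/-- If two consecutive hulls agree, then `u ↦ θ_{i+1} u ⊕ Δ_{i+1} u` is onto: the elements of the
larger hull arise from arbitrary pairs `(y, d)`, with `y ∈ Γ ⊗ E_{i+2}` and `d` the component at
`i + 1`, and determine them; those of the smaller hull have pairs `(θ_{i+1} u, Δ_{i+1} u)`. -/
theorem graph_surjective_of_chainHull_eq {k : ℕ}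
    {θ : ∀ i, Fock n (E i) →L[ℂ] Fock n (E (i + 1))}
    (hθ : ∀ i, 1 ≤ i → i ≤ k → ‖θ i‖ ≤ 1) {Θ : Fock n (E 1) →L[ℂ] Fock n (E (k + 1))}
    (hΘ : ‖Θ‖ ≤ 1) (hfac : Θ = prodFactors θ (Nat.le_add_left 1 k))
    (hreg : IsRegularFactorization k θ) {i : ℕ} (hi : i ≤ k) (hi' : i + 1 ≤ k)
    (h : chainHull k θ Θ i hi = chainHull k θ Θ (i + 1) hi') (y : Fock n (E (i + 1 + 1)))
    (d : defectSpace (θ (i + 1))) :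
    ∃ u, θ (i + 1) u = y ∧ defectMap (θ (i + 1)) u = d := by
  -- A point of the larger hull with parameter `y` and component `d` at `i + 1`.
  let m : Finset.Icc 1 k := ⟨i + 1, Finset.mem_Icc.2 ⟨by omega, hi'⟩⟩
  let w₀ : ∀ j : Finset.Icc 1 k, defectSpace (θ j) := fun j =>
    if hj : i + 1 + 1 ≤ j then defectMap (θ j) (prodFactors θ hj y) else 0
  let w : defectSum k θ := WithLp.toLp 2 (Function.update w₀ m d)
  have hwm : w m = d := by simp [w]
  have hw (j : Finset.Icc 1 k) (hj : i + 1 + 1 ≤ (j : ℕ)) :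
      w j = defectMap (θ j) (prodFactors θ hj y) := by
    have hne : j ≠ m := by
      rintro rfl
      simp [m] at hj
    exact (Function.update_of_ne hne d w₀).trans (dif_pos hj)
  have hmem : WithLp.toLp 2 (prodFactors θ (Nat.succ_le_succ hi') y,
      ((defectIsometry k θ Θ)†) w) ∈ chainHull k θ Θ i hi := by
    rw [h]
    exact ⟨y, w, hw, rfl⟩
  obtain ⟨u, w', hw', heq⟩ := hmem
  rw [(WithLp.toLp_injective 2).eq_iff, Prod.mk.injEq] at heq
  obtain rfl := defectIsometry_adjoint_injective hθ hΘ hfac hreg heq.2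
  refine ⟨u, ?_, ?_⟩
  · -- `θ_{i+1} u` and `y` have the same image under `θ_k ⋯ θ_{i+2}` and the same defect
    -- components.
    rw [← sub_eq_zero]
    refine eq_zero_of_prodFactors_eq_zero (Nat.succ_le_succ hi')
      (fun j h1 h2 => hθ j (by omega) (by omega)) ?_ fun j h1 h2 => ?_
    · rw [map_sub, heq.1, ← prodFactors_succ_left θ (Nat.succ_le_succ hi), sub_self]
    · have hj : j ∈ Finset.Icc 1 k := Finset.mem_Icc.2 ⟨by omega, by omega⟩
      rw [map_sub, map_sub, ← hw ⟨j, hj⟩ h1, hw' ⟨j, hj⟩ (by simp; omega),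
        ← prodFactors_succ_left θ (by omega : i + 1 ≤ j), sub_self]
  · rw [← hwm, hw' m le_rfl, prodFactors_self]
    rfl

/-- If `θ_{i+1}` is a unitary constant, it has zero defect space, so passing from `u` to `θ_{i+1} u`
only reparametrises the hull. -/
theorem chainHull_succ_le_of_isUnitaryConstant {k : ℕ}
    {θ : ∀ i, Fock n (E i) →L[ℂ] Fock n (E (i + 1))}
    (hθ : ∀ i, 1 ≤ i → i ≤ k → ‖θ i‖ ≤ 1) (Θ : Fock n (E 1) →L[ℂ] Fock n (E (k + 1)))
    {i : ℕ} (hi : i ≤ k) (hi' : i + 1 ≤ k) (hu : IsUnitaryConstant (θ (i + 1))) :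
    chainHull k θ Θ (i + 1) hi' ≤ chainHull k θ Θ i hi := by
  have hsub (d : defectSpace (θ (i + 1))) : d = 0 := by
    refine (denseRange_defectMap (θ (i + 1))).induction_on d
      (isClosed_eq continuous_id continuous_const) fun f => Subtype.ext ?_
    have h := norm_defect_sq _ (hθ (i + 1) (by omega) hi') f
    rw [hu.norm_apply, sub_self, sq_eq_zero_iff, norm_eq_zero] at h
    exact h
  rintro _ ⟨v, w, hw, rfl⟩
  obtain ⟨u, rfl⟩ := hu.surjective v
  refine ⟨u, w, ?_, ?_⟩
  · rintro ⟨j, hj'⟩ hj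
    change i + 1 ≤ j at hj
    obtain rfl | hlt := eq_or_lt_of_le hj
    · exact (hsub _).trans (hsub _).symm
    · rw [hw ⟨j, hj'⟩ hlt, ← prodFactors_succ_left θ hj]
  · rw [← prodFactors_succ_left θ (Nat.succ_le_succ hi)]

end Factorization

end RegularFactorization

theorem mainTheorem7 (n k : ℕ) (E : ℕ → Type*) [∀ i, NormedAddCommGroup (E i)]
    [∀ i, InnerProductSpace ℂ (E i)] [∀ i, CompleteSpace (E i)]
    (Θ : Fock n (E 1) →L[ℂ] Fock n (E (k + 1)))
    (θ : ∀ i, Fock n (E i) →L[ℂ] Fock n (E (i + 1)))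
    (hΘ : IsContractiveMultiAnalytic Θ)
    (hpure : IsPurelyContractive Θ)
    (hszego : SzegoCondition Θ)
    (hθ : ∀ i, 1 ≤ i → i ≤ k → IsContractiveMultiAnalytic (θ i))
    (hfac : Θ = prodFactors θ (Nat.le_add_left 1 k))
    (hreg : IsRegularFactorization k θ)
    (i : ℕ) (hi : 1 ≤ i) (hik : i + 2 ≤ k) :
    chainSubspace k θ Θ i (by omega) = chainSubspace k θ Θ (i + 1) (by omega) ↔
      IsUnitaryConstant (θ (i + 1)) := by
  have hθ' : ∀ i, 1 ≤ i → i ≤ k → ‖θ i‖ ≤ 1 := fun j h1 h2 => (hθ j h1 h2).contractive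
  rw [chainSubspace_eq_iff hθ' hΘ.contractive hfac]
  refine ⟨fun h => ?_, fun hu => le_antisymm (chainHull_le_succ θ Θ _ _)
    (chainHull_succ_le_of_isUnitaryConstant hθ' Θ _ _ hu)⟩
  have hT := hθ (i + 1) (by omega) (by omega)
  have hs := graph_surjective_of_chainHull_eq hθ' hΘ.contractive hfac hreg _ _ h
  exact isUnitaryConstant_of_graph_surjective hT hs
    (defect_apply_nil_eq_zero_of_szego hθ hΘ.contractive hfac hreg hszego (by omega) (by omega)
      fun f hf => apply_nil_eq_zero_of_intertwines
        (defect_intertwines_of_graph_surjective hT hs) hf)
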